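/- Let $p$ be a prime and let $\Delta_p$ be the compact additive group of $p$-adic integers with its Borel $\sigma$-algebra; write $x_0,x_1,\ldots\in\{0,\dots,p-1\}$ for the digits of $x=\sum_{j\ge0}x_jp^j\in\Delta_p$, and $\widehat\Delta_p$ for the group of continuous characters $\chi:\Delta_p\to\{z\in\mathbb C:|z|=1\}$. A (possibly infinite) Borel measure $\eta$ on $\Delta_p$ is a Lévy measure if $\eta(\{0\})=0$, $\eta(\Delta_p\setminus U)<\infty$ for every Borel neighbourhood $U$ of $0$, and $\int_{\Delta_p}(1-\operatorname{Re}\chi)\,d\eta<\infty$ for every $\chi\in\widehat\Delta_p$. Theorem (Poisson limit theorem on the $p$-adic integers). Let $\{X_{n,k}:n\in\mathbb N,\ 1\le k\le K_n\}$ be a rowwise independent array of random elements of $\Delta_p$, and let $\eta$ be a Lévy measure on $\Delta_p$ such that (i) $\displaystyle\max_{1\le k\le K_n}\mathrm P\big(((X_{n,k})_0,\dots,(X_{n,k})_d)\neq 0\big)\to0$ as $n\to\infty$, for every integer $d\ge0$; (ii) $\displaystyle\sum_{k=1}^{K_n}\mathrm P\big((X_{n,k})_0=\ell_0,\dots,(X_{n,k})_d=\ell_d\big)\to\eta\big(\{x\in\Delta_p:x_0=\ell_0,\dots,x_d=\ell_d\}\big)$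 as $n\to\infty$, for every integer $d\ge0$ and all $\ell_0,\dots,\ell_d\in\{0,\dots,p-1\}$ with $(\ell_0,\dots,\ell_d)\ne0$. Then the array is infinitesimal, i.e. $\max_{1\le k\le K_n}\mathrm P(X_{n,k}\in\Delta_p\setminus U)\to0$ for every Borel neighbourhood $U$ of $0$. Moreover, the generalized Poisson measure $\pi_{\eta,0}$, that is, the probability measure on $\Delta_p$ determined by $$\int_{\Delta_p}\chi\,d\pi_{\eta,0}=\exp\Big\{\int_{\Delta_p}(\chi(x)-1)\,d\eta(x)\Big\}\qquad\text{for all }\chi\in\widehat\Delta_p,$$ exists and is unique, and the row sums $\sum_{k=1}^{K_n}X_{n,k}$ converge in distribution to $\pi_{\eta,0}$ as $n\to\infty$. -/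

import Mathlib

open MeasureTheory ProbabilityTheory Filter Topology
open scoped ENNReal

noncomputable section

namespace PoissonLimit

/-! ### Locally compact abelian groups (written additively) -/

section General

variable (G : Type*) [AddCommGroup G] [TopologicalSpace G]

/-- The group of continuous characters `G → Circle` of an additively written topological group,
with the compact-open topology. -/
abbrev Dual := PontryaginDual (Multiplicative G)

variable {G}

/-- The value `χ(x)` of a character, as a complex number. -/
def charVal (χ : Dual G) (x : G) : ℂ := (χ (Multiplicative.ofAdd x) : ℂ)

variable (G) in
/-- A local inner product for `G`. -/
structure LocalInnerProduct [MeasurableSpace G] where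
  /-- the underlying function `G × Ĝ → ℝ` -/
  toFun : G → Dual G → ℝ
  continuous_toFun : Continuous (fun q : G × Dual G => toFun q.1 q.2)
  /-- near the identity, `χ(x) = exp(i g(x, χ))`, uniformly for `χ` in a compact set -/
  char_eq : ∀ C : Set (Dual G), IsCompact C → ∃ U ∈ 𝓝 (0 : G), MeasurableSet U ∧
    ∀ x ∈ U, ∀ χ ∈ C, charVal χ x = Complex.exp (Complex.I * (toFun x χ : ℂ))
  map_mul : ∀ (x : G) (χ₁ χ₂ : Dual G), toFun x (χ₁ * χ₂) = toFun x χ₁ + toFun x χ₂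
  map_neg : ∀ (x : G) (χ : Dual G), toFun (-x) χ = -toFun x χ
  bounded : ∀ C : Set (Dual G), IsCompact C → ∃ M : ℝ, ∀ x : G, ∀ χ ∈ C, |toFun x χ| ≤ M
  tendsto_zero : ∀ C : Set (Dual G), IsCompact C → ∀ ε : ℝ, 0 < ε →
    ∀ᶠ x in 𝓝 (0 : G), ∀ χ ∈ C, |toFun x χ| ≤ ε

/-- `η` is a Lévy measure on `G`. -/
structure IsLevyMeasure [MeasurableSpace G] (η : Measure G) : Prop where
  zero : η {0} = 0
  finite_compl : ∀ U ∈ 𝓝 (0 : G), MeasurableSet U → η Uᶜ < ∞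
  lintegral_lt : ∀ χ : Dual G, ∫⁻ x, ENNReal.ofReal (1 - (charVal χ x).re) ∂η < ∞

/-- The probability measure `π` is the generalized Poisson measure `π_{η, g}`: its Fourier
transform at `χ` is `exp (∫ (χ(x) - 1 - i g(x, χ)) dη(x))`. -/
def IsGeneralizedPoisson [MeasurableSpace G] (η : Measure G) (g : LocalInnerProduct G)
    (π : ProbabilityMeasure G) : Prop :=
  ∀ χ : Dual G,
    Integrable (fun x => charVal χ x - 1 - Complex.I * (g.toFun x χ : ℂ)) η ∧
    ∫ x, charVal χ x ∂(π : Measure G) =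
      Complex.exp (∫ x, (charVal χ x - 1 - Complex.I * (g.toFun x χ : ℂ)) ∂η)

/-- Infinitesimality of a triangular array whose `n`-th row has entries `X n k`, `k < K n`, defined
on the probability space `(Ω n, P n)`. A supremum over an empty row is `0`. -/
def IsInfinitesimal [MeasurableSpace G] {Ω : ℕ → Type*} [∀ n, MeasurableSpace (Ω n)]
    (P : ∀ n, Measure (Ω n)) {K : ℕ → ℕ} (X : ∀ n, Fin (K n) → Ω n → G) : Prop :=
  ∀ U ∈ 𝓝 (0 : G), MeasurableSet U →
    Tendsto (fun n => ⨆ k : Fin (K n), P n {ω | X n k ω ∈ Uᶜ}) atTop (𝓝 0)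

end General

/-! ### The group of `p`-adic integers -/

section Padic

variable {p : ℕ} [hp : Fact p.Prime]

lemma appr_div_lt (x : ℤ_[p]) (j : ℕ) : x.appr (j + 1) / p ^ j < p := by
  rw [Nat.div_lt_iff_lt_mul (pow_pos hp.out.pos j), ← pow_succ']
  exact x.appr_lt (j + 1)

/-- The `j`-th digit `x_j ∈ {0, …, p - 1}` of `x = ∑ x_j p ^ j`. Here `x.appr n` is the
representative of `x` modulo `p ^ n` in `{0, …, p ^ n - 1}`. -/
def digit (x : ℤ_[p]) (j : ℕ) : Fin p := ⟨x.appr (j + 1) / p ^ j, appr_div_lt x j⟩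

lemma appr_eq_sum_digit (x : ℤ_[p]) (n : ℕ) :
    x.appr n = ∑ j ∈ Finset.range n, (digit x j : ℕ) * p ^ j := by
  induction n with
  | zero => simpa using x.appr_lt 0
  | succ n ih =>
    rw [Finset.sum_range_succ, ← ih]
    have hmono := x.appr_mono (Nat.le_succ n)
    obtain ⟨c, hc⟩ := x.dvd_appr_sub_appr n (n + 1) (Nat.le_succ n)
    have h1 : x.appr (n + 1) = x.appr n + p ^ n * c := by
      simp only [Nat.succ_eq_add_one] at hmono
      omega
    have hd : (digit x n : ℕ) = c := by
      change x.appr (n + 1) / p ^ n = c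
      rw [h1, Nat.add_mul_div_left _ _ (pow_pos hp.out.pos n), Nat.div_eq_of_lt (x.appr_lt n),
        zero_add]
    rw [hd, h1, mul_comm]

/-- The digits of `x` are those of its `p`-adic expansion. -/
lemma tendsto_sum_digit (x : ℤ_[p]) :
    Tendsto (fun n => ∑ j ∈ Finset.range n, ((digit x j : ℕ) : ℤ_[p]) * (p : ℤ_[p]) ^ j)
      atTop (𝓝 x) := by
  have h : ∀ n, ∑ j ∈ Finset.range n, ((digit x j : ℕ) : ℤ_[p]) * (p : ℤ_[p]) ^ j
      = (x.appr n : ℤ_[p]) := by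
    intro n
    rw [appr_eq_sum_digit]
    push_cast
    rfl
  simp only [h]
  rw [tendsto_iff_norm_sub_tendsto_zero]
  have hlim : Tendsto (fun n : ℕ => ((p : ℝ)⁻¹) ^ n) atTop (𝓝 0) :=
    tendsto_pow_atTop_nhds_zero_of_lt_one (by positivity)
      (inv_lt_one_of_one_lt₀ (by exact_mod_cast hp.out.one_lt))
  refine squeeze_zero (fun _ => norm_nonneg _) (fun n => ?_) hlim
  rw [norm_sub_rev]
  have := (PadicInt.norm_le_pow_iff_mem_span_pow (x - (x.appr n : ℤ_[p])) n).2 (x.appr_spec n)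
  simpa [zpow_neg, inv_pow] using this

/-- Every character of `ℤ_p` is trivial near `0`. -/
lemma eventually_charVal_eq_one (χ : Dual ℤ_[p]) : ∀ᶠ x in 𝓝 (0 : ℤ_[p]), charVal χ x = 1 := by
  have hcont : Continuous (fun x : ℤ_[p] => χ (Multiplicative.ofAdd x)) :=
    (map_continuous χ).comp continuous_ofAdd
  have hopen : IsOpen ((fun x : ℤ_[p] => χ (Multiplicative.ofAdd x)) ⁻¹'
      Circle.centeredArc (Real.pi / 2)) := (Circle.isOpen_centeredArc _).preimage hcont
  have h0 : (0 : ℤ_[p]) ∈ (fun x : ℤ_[p] => χ (Multiplicative.ofAdd x)) ⁻¹'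
      Circle.centeredArc (Real.pi / 2) := by
    rw [Set.mem_preimage, ofAdd_zero, map_one,
      Circle.mem_centeredArc (by linarith [Real.pi_pos])]
    simp [Real.pi_pos]
  obtain ⟨r, hr, hball⟩ := Metric.isOpen_iff.1 hopen 0 h0
  filter_upwards [Metric.ball_mem_nhds (0 : ℤ_[p]) hr] with x hx
  have : χ (Multiplicative.ofAdd x) = 1 := by
    refine Circle.eq_one_of_forall_pow_mem_centeredArc_pi_div_two fun n _ => ?_
    rw [← map_pow, ← ofAdd_nsmul]
    refine hball ?_
    rw [mem_ball_zero_iff] at hx ⊢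
    rw [nsmul_eq_mul]
    refine lt_of_le_of_lt ?_ hx
    rw [norm_mul]
    exact mul_le_of_le_one_left (norm_nonneg _) (PadicInt.norm_le_one _)
  simp [charVal, this]

variable (p) in
/-- The local inner product `g = 0` for the group of `p`-adic integers. -/
def zeroLocalInnerProduct [MeasurableSpace ℤ_[p]] [BorelSpace ℤ_[p]] :
    LocalInnerProduct ℤ_[p] where
  toFun _ _ := 0
  continuous_toFun := continuous_const
  char_eq C hC := by
    have hfin : C.Finite := hC.finite_of_discrete
    have hev : ∀ᶠ x in 𝓝 (0 : ℤ_[p]), ∀ χ ∈ C, charVal χ x = 1 :=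
      (Set.Finite.eventually_all hfin).2 fun χ _ => eventually_charVal_eq_one χ
    obtain ⟨U, hU, hUo, h0⟩ := eventually_nhds_iff.1 hev
    exact ⟨U, hUo.mem_nhds h0, hUo.measurableSet, fun x hx χ hχ => by simpa using hU x hx χ hχ⟩
  map_mul _ _ _ := by simp
  map_neg _ _ := by simp
  bounded _ _ := ⟨0, by simp⟩
  tendsto_zero _ _ ε hε := by simp [hε.le]

end Padic

end PoissonLimit

end

namespace PoissonLimit

/-! ### Characters and their integrals -/

section Characters

variable {G : Type*} [AddCommGroup G] [TopologicalSpace G]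

/-! A character of `ℤ_[p]` is trivial on a ball around `0`, hence depends on finitely many digits
(`exists_charVal_eq_comp_digits`). So `χ - 1` is a finite combination of indicators of digit
cylinders, and the cylinder of `0`, where `η` may be infinite, has coefficient `0`. The hypotheses
control exactly the remaining cylinders.

Put `z n k = E χ(X n k) - 1`. Convergence of the cylinder sums gives `∑ z n k → ∫ (χ - 1) dη` and
eventually bounds `∑ ‖z n k‖`; smallness of the individual probabilities gives `max ‖z n k‖ → 0`. By
independence the transform of the row sum is `∏ (1 + z n k)`, which is then asymptotic to `exp (∑ z
n k)` (`tendsto_prod_one_add_exp`, `tendsto_integral_charVal_sum`).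

Since `ℤ_[p]` is compact and its characters separate points, pointwise convergence of transforms
forces weak convergence (`exists_tendsto_of_tendsto_integral_charVal`). This also produces the
generalized Poisson measure, as the limit of the laws of the row sums. -/

lemma charVal_zero (χ : Dual G) : charVal χ 0 = 1 := by simp [charVal]

lemma charVal_add (χ : Dual G) (x y : G) : charVal χ (x + y) = charVal χ x * charVal χ y := by
  simp [charVal]

lemma charVal_sum (χ : Dual G) {ι : Type*} (s : Finset ι) (x : ι → G) :
    charVal χ (∑ i ∈ s, x i) = ∏ i ∈ s, charVal χ (x i) := by
  classical
  induction s using Finset.induction_on with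
  | empty => simp [charVal_zero]
  | insert i s hi ih => rw [Finset.sum_insert hi, Finset.prod_insert hi, charVal_add, ih]

lemma charVal_one (x : G) : charVal (1 : Dual G) x = 1 := by simp [charVal]

lemma charVal_mul (χ ψ : Dual G) (x : G) : charVal (χ * ψ) x = charVal χ x * charVal ψ x := rfl

lemma charVal_inv (χ : Dual G) (x : G) : charVal χ⁻¹ x = star (charVal χ x) :=
  Circle.coe_inv_eq_conj (χ (Multiplicative.ofAdd x))

lemma norm_charVal (χ : Dual G) (x : G) : ‖charVal χ x‖ = 1 :=
  Circle.norm_coe (χ (Multiplicative.ofAdd x))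

lemma continuous_charVal (χ : Dual G) : Continuous (charVal χ) :=
  continuous_subtype_val.comp ((map_continuous χ).comp continuous_ofAdd)

/-- A character as a bounded continuous function. -/
noncomputable def charBCF (χ : Dual G) : BoundedContinuousFunction G ℂ :=
  BoundedContinuousFunction.ofNormedAddCommGroup (charVal χ) (continuous_charVal χ) 1
    fun x => (norm_charVal χ x).le

@[simp]
lemma charBCF_apply (χ : Dual G) (x : G) : charBCF χ x = charVal χ x := rfl

variable (G) in
/-- The characters form a submonoid of the bounded continuous functions. -/
noncomputable def charSubmonoid : Submonoid (BoundedContinuousFunction G ℂ) where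
  carrier := Set.range charBCF
  one_mem' := ⟨1, by ext x; simp [charVal_one]⟩
  mul_mem' := by
    rintro _ _ ⟨χ, rfl⟩ ⟨ψ, rfl⟩
    exact ⟨χ * ψ, by ext x; simp [charVal_mul]⟩

variable (G) in
/-- The algebra of trigonometric polynomials. -/
noncomputable def trigPoly : StarSubalgebra ℂ (BoundedContinuousFunction G ℂ) where
  toSubalgebra := Algebra.adjoin ℂ (charSubmonoid G : Set (BoundedContinuousFunction G ℂ))
  star_mem' := by
    intro f hf
    change f ∈ Algebra.adjoin ℂ _ at hf
    change star f ∈ Algebra.adjoin ℂ _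
    induction hf using Algebra.adjoin_induction with
    | mem f hf =>
      obtain ⟨χ, rfl⟩ := hf
      exact Algebra.subset_adjoin ⟨χ⁻¹, by ext x; simp [charVal_inv]⟩
    | algebraMap r =>
      rw [← algebraMap_star_comm]
      exact Subalgebra.algebraMap_mem _ _
    | add f g _ _ hf hg => rw [star_add]; exact add_mem hf hg
    | mul f g _ _ hf hg => rw [star_mul]; exact mul_mem hg hf

/-- Finite measures on a Polish group are determined by their Fourier transforms if the characters
separate points. -/
theorem measure_ext_of_integral_charVal [PolishSpace G] [MeasurableSpace G] [BorelSpace G]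
    (hsep : ∀ x y : G, x ≠ y → ∃ χ : Dual G, charVal χ x ≠ charVal χ y)
    {μ ν : Measure G} [IsFiniteMeasure μ] [IsFiniteMeasure ν]
    (h : ∀ χ : Dual G, ∫ x, charVal χ x ∂μ = ∫ x, charVal χ x ∂ν) : μ = ν := by
  refine ext_of_forall_mem_subalgebra_integral_eq_of_polish (𝕜 := ℂ) (A := trigPoly G) ?_ ?_
  · intro x y hxy
    obtain ⟨χ, hχ⟩ := hsep x y hxy
    refine ⟨charVal χ, ⟨(charBCF χ).toContinuousMap, ⟨charBCF χ, ?_, rfl⟩, rfl⟩, hχ⟩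
    exact Algebra.subset_adjoin ⟨χ, rfl⟩
  · intro f hf
    -- A product of characters is a character, so the algebra they generate is just their linear
    -- span, and linearity of the integral suffices.
    have hf' : f ∈ Submodule.span ℂ (charSubmonoid G : Set (BoundedContinuousFunction G ℂ)) := by
      have h1 : f ∈ Subalgebra.toSubmodule
        (Algebra.adjoin ℂ (charSubmonoid G : Set (BoundedContinuousFunction G ℂ))) := hf
      rwa [Algebra.adjoin_eq_span, Submonoid.closure_eq] at h1
    clear hf
    induction hf' using Submodule.span_induction with
    | mem f hf => obtain ⟨χ, rfl⟩ := hf; exact h χ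
    | zero => simp
    | add f g _ _ hf hg =>
      simp only [BoundedContinuousFunction.coe_add, Pi.add_apply]
      rw [integral_add (f.integrable μ) (g.integrable μ),
        integral_add (f.integrable ν) (g.integrable ν), hf, hg]
    | smul c f _ hf =>
      simp only [BoundedContinuousFunction.coe_smul, integral_smul, hf]

end Characters

/-! ### Products close to exponentials -/

/-- Telescoping: factors are exchanged one at a time, the others having norm at most `1`. -/
lemma norm_prod_sub_prod_le_sum {ι : Type*} (s : Finset ι) {a b : ι → ℂ}
    (ha : ∀ i ∈ s, ‖a i‖ ≤ 1) (hb : ∀ i ∈ s, ‖b i‖ ≤ 1) :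
    ‖∏ i ∈ s, a i - ∏ i ∈ s, b i‖ ≤ ∑ i ∈ s, ‖a i - b i‖ := by
  classical
  induction s using Finset.induction_on with
  | empty => simp
  | insert i s hi ih =>
    rw [Finset.prod_insert hi, Finset.prod_insert hi, Finset.sum_insert hi]
    have hih := ih (fun j hj => ha j (Finset.mem_insert_of_mem hj))
      (fun j hj => hb j (Finset.mem_insert_of_mem hj))
    have h1 : ‖∏ j ∈ s, a j‖ ≤ 1 := by
      rw [norm_prod]
      exact Finset.prod_le_one (fun _ _ => norm_nonneg _)
        fun j hj => ha j (Finset.mem_insert_of_mem hj)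
    calc ‖a i * ∏ j ∈ s, a j - b i * ∏ j ∈ s, b j‖
        = ‖(a i - b i) * ∏ j ∈ s, a j + b i * (∏ j ∈ s, a j - ∏ j ∈ s, b j)‖ := by
          congr 1; ring
      _ ≤ ‖a i - b i‖ * 1 + 1 * ‖∏ j ∈ s, a j - ∏ j ∈ s, b j‖ := by
          refine (norm_add_le _ _).trans ?_
          rw [norm_mul, norm_mul]
          gcongr
          exact hb i (Finset.mem_insert_self i s)
      _ ≤ _ := by linarith

/-- Expanding `‖1 + z‖² ≤ 1` gives `2 Re z + ‖z‖² ≤ 0`, so `Re z ≤ 0`. -/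
lemma norm_exp_le_one_of_norm_one_add_le_one {z : ℂ} (hz : ‖1 + z‖ ≤ 1) : ‖Complex.exp z‖ ≤ 1 := by
  have h1 : Complex.normSq (1 + z) ≤ 1 := by
    rw [Complex.normSq_eq_norm_sq]
    exact pow_le_one₀ (norm_nonneg _) hz
  rw [Complex.normSq_apply] at h1
  simp only [Complex.add_re, Complex.one_re, Complex.add_im, Complex.one_im, zero_add] at h1
  rw [Complex.norm_exp, Real.exp_le_one_iff]
  nlinarith [sq_nonneg z.re, sq_nonneg z.im]

/-- The products `∏ (1 + z n k)` over the rows of an infinitesimal array of bounded total mass are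
asymptotic to the exponentials of the row sums. -/
theorem tendsto_prod_one_add_exp {K : ℕ → ℕ} {z : ∀ n, Fin (K n) → ℂ} {w : ℂ} {M : ℝ}
    {ε : ℕ → ℝ} (hz : ∀ n k, ‖1 + z n k‖ ≤ 1) (hle : ∀ n k, ‖z n k‖ ≤ ε n)
    (hε : Tendsto ε atTop (𝓝 0)) (hε0 : ∀ n, 0 ≤ ε n)
    (hM : ∀ᶠ n in atTop, ∑ k, ‖z n k‖ ≤ M)
    (hw : Tendsto (fun n => ∑ k, z n k) atTop (𝓝 w)) :
    Tendsto (fun n => ∏ k, (1 + z n k)) atTop (𝓝 (Complex.exp w)) := by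
  have hexp : Tendsto (fun n => ∏ k, Complex.exp (z n k)) atTop (𝓝 (Complex.exp w)) := by
    simp_rw [← Complex.exp_sum]
    exact (Complex.continuous_exp.tendsto w).comp hw
  have hdiff : Tendsto (fun n => ∏ k, (1 + z n k) - ∏ k, Complex.exp (z n k)) atTop (𝓝 0) := by
    refine squeeze_zero_norm' ?_ (by simpa using hε.mul_const M)
    filter_upwards [hM, hε.eventually_le_const zero_lt_one] with n hn h1
    calc ‖∏ k, (1 + z n k) - ∏ k, Complex.exp (z n k)‖
        ≤ ∑ k, ‖1 + z n k - Complex.exp (z n k)‖ := norm_prod_sub_prod_le_sum _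
          (fun k _ => hz n k) fun k _ => norm_exp_le_one_of_norm_one_add_le_one (hz n k)
      _ ≤ ∑ k, ε n * ‖z n k‖ := by
          refine Finset.sum_le_sum fun k _ => ?_
          -- For `‖z‖ ≤ 1` one has `‖exp z - 1 - z‖ ≤ ‖z‖²`, and one factor `‖z‖` is at most `ε n`.
          rw [norm_sub_rev, ← sub_sub]
          refine (Complex.norm_exp_sub_one_sub_id_le ((hle n k).trans h1)).trans ?_
          rw [sq]
          gcongr
          exact hle n k
      _ ≤ ε n * M := by
          rw [← Finset.mul_sum]
          exact mul_le_mul_of_nonneg_left hn (hε0 n)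
  simpa using hdiff.add hexp

/-! ### Digits of `p`-adic integers -/

section Digits

variable {p : ℕ} [hp : Fact p.Prime]

/-- Both sides express congruence modulo `p ^ n`: `appr n` is the reduced representative, and the
ball is the kernel of `toZModPow n`. -/
lemma appr_eq_iff_norm_sub_le (x y : ℤ_[p]) (n : ℕ) :
    x.appr n = y.appr n ↔ ‖x - y‖ ≤ (p : ℝ) ^ (-n : ℤ) := by
  rw [PadicInt.norm_le_pow_iff_mem_span_pow, ← PadicInt.ker_toZModPow, RingHom.mem_ker, map_sub,
    sub_eq_zero]
  change _ ↔ ((x.appr n : ℕ) : ZMod (p ^ n)) = ((y.appr n : ℕ) : ZMod (p ^ n))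
  rw [ZMod.natCast_eq_natCast_iff', Nat.mod_eq_of_lt (x.appr_lt n), Nat.mod_eq_of_lt (y.appr_lt n)]

/-- The first `d + 1` digits of a `p`-adic integer. -/
noncomputable def digits (d : ℕ) (x : ℤ_[p]) : Fin (d + 1) → Fin p := fun j => digit x j

lemma digits_eq_iff_norm_sub_le (x y : ℤ_[p]) (d : ℕ) :
    digits d x = digits d y ↔ ‖x - y‖ ≤ (p : ℝ) ^ (-(d + 1 : ℕ) : ℤ) := by
  constructor
  · intro h
    rw [← appr_eq_iff_norm_sub_le, appr_eq_sum_digit, appr_eq_sum_digit]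
    refine Finset.sum_congr rfl fun j hj => ?_
    have := congrFun h ⟨j, Finset.mem_range.1 hj⟩
    simp only [digits] at this
    rw [this]
  · intro h
    funext j
    have h1 : x.appr (j + 1) = y.appr (j + 1) := by
      rw [appr_eq_iff_norm_sub_le]
      refine h.trans (zpow_le_zpow_right₀ (by exact_mod_cast hp.out.one_lt.le) ?_)
      have := j.2
      push_cast
      omega
    simp only [digits, digit, h1]

lemma digit_zero_right (j : ℕ) : (digit (0 : ℤ_[p]) j : ℕ) = 0 := by
  have h : (0 : ℤ_[p]).appr (j + 1) = 0 := by
    have h1 : (PadicInt.toZModPow (j + 1)) (0 : ℤ_[p]) = 0 := map_zero _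
    change (((0 : ℤ_[p]).appr (j + 1) : ℕ) : ZMod (p ^ (j + 1))) = 0 at h1
    rw [ZMod.natCast_eq_zero_iff] at h1
    exact Nat.eq_zero_of_dvd_of_lt h1 (PadicInt.appr_lt _ _)
  simp only [digit, h, Nat.zero_div]

lemma ne_digits_zero_iff (d : ℕ) (l : Fin (d + 1) → Fin p) :
    l ≠ digits d 0 ↔ ∃ j, (l j : ℕ) ≠ 0 := by
  simp only [ne_eq, funext_iff, Fin.ext_iff, digits, digit_zero_right, not_forall]

lemma exists_digit_ne_zero_iff (d : ℕ) (x : ℤ_[p]) :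
    (∃ j ≤ d, (digit x j : ℕ) ≠ 0) ↔ digits d x ≠ digits d 0 := by
  rw [ne_digits_zero_iff]
  exact ⟨fun ⟨j, hj, h⟩ => ⟨⟨j, by omega⟩, h⟩, fun ⟨j, h⟩ => ⟨j, by omega, h⟩⟩

lemma isLocallyConstant_digits (d : ℕ) : IsLocallyConstant (digits (p := p) d) := by
  rw [IsLocallyConstant.iff_eventually_eq]
  intro x
  have hpos : (0 : ℝ) < (p : ℝ) ^ (-(d + 1 : ℕ) : ℤ) :=
    zpow_pos (by exact_mod_cast hp.out.pos) _
  filter_upwards [Metric.ball_mem_nhds x hpos] with y hy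
  rw [digits_eq_iff_norm_sub_le, ← dist_eq_norm]
  exact (Metric.mem_ball.1 hy).le

/-- The sets where the first digits vanish form a basis of neighbourhoods of `0`. -/
lemma exists_digits_eq_subset {U : Set ℤ_[p]} (hU : U ∈ 𝓝 0) :
    ∃ d, ∀ x, digits d x = digits d 0 → x ∈ U := by
  obtain ⟨r, hr, hball⟩ := Metric.mem_nhds_iff.1 hU
  obtain ⟨d, hd⟩ := PadicInt.exists_pow_neg_lt p hr
  refine ⟨d, fun x hx => hball ?_⟩
  rw [digits_eq_iff_norm_sub_le] at hx
  rw [Metric.mem_ball, dist_eq_norm]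
  refine lt_of_le_of_lt (hx.trans ?_) hd
  refine zpow_le_zpow_right₀ (by exact_mod_cast hp.out.one_lt.le) ?_
  push_cast
  omega

/-- A character of `ℤ_p` depends on finitely many digits only. -/
lemma exists_charVal_eq_comp_digits (χ : Dual ℤ_[p]) :
    ∃ (d : ℕ) (g : (Fin (d + 1) → Fin p) → ℂ),
      (∀ x, charVal χ x = g (digits d x)) ∧ ∀ l, ‖g l‖ ≤ 1 := by
  obtain ⟨d, hd⟩ := exists_digits_eq_subset (eventually_charVal_eq_one χ)
  -- If `x` and `y` share their first digits, then `x - y` lies in the ball where `χ` is trivial.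
  have hfac : ∀ x y : ℤ_[p], digits d x = digits d y → charVal χ x = charVal χ y := by
    intro x y hxy
    have h : charVal χ (x - y) = 1 := by
      refine hd _ ?_
      rw [digits_eq_iff_norm_sub_le] at hxy ⊢
      simpa using hxy
    rw [← sub_add_cancel x y, charVal_add, h, one_mul]
  have hF : Function.FactorsThrough (charVal χ) (digits (p := p) d) := fun x y h => hfac x y h
  -- The value `0` off the range of `digits d` keeps the bound `‖g l‖ ≤ 1` without proving
  -- surjectivity.
  refine ⟨d, Function.extend (digits d) (charVal χ) 0, fun x => (hF.extend_apply 0 x).symm, ?_⟩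
  intro l
  by_cases hl : ∃ x, digits d x = l
  · obtain ⟨x, rfl⟩ := hl
    rw [hF.extend_apply, norm_charVal]
  · rw [Function.extend_apply' _ _ _ hl]
    simp

/-- The characters of `ℤ_p` separate points. -/
lemma exists_charVal_ne {x y : ℤ_[p]} (hxy : x ≠ y) :
    ∃ χ : Dual ℤ_[p], charVal χ x ≠ charVal χ y := by
  -- Distinct points differ modulo some `p ^ n`; a faithful character of `ZMod (p ^ n)` is pulled
  -- back along the reduction.
  obtain ⟨n, hn⟩ : ∃ n, PadicInt.toZModPow n x ≠ PadicInt.toZModPow n y := by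
    by_contra! h
    exact hxy (PadicInt.ext_of_toZModPow.1 h)
  have hne : NeZero (p ^ n) := ⟨pow_ne_zero _ hp.out.ne_zero⟩
  let ψ : AddChar (ZMod (p ^ n)) Circle := ZMod.toCircle
  let f : Multiplicative ℤ_[p] →* Circle :=
    ψ.toMonoidHom.comp (AddMonoidHom.toMultiplicative (PadicInt.toZModPow n).toAddMonoidHom)
  have hcont : Continuous (fun x : ℤ_[p] => PadicInt.toZModPow n x) := by
    refine IsLocallyConstant.continuous ((IsLocallyConstant.iff_eventually_eq _).2 fun z => ?_)
    have hpos : (0 : ℝ) < (p : ℝ) ^ (-n : ℤ) := zpow_pos (by exact_mod_cast hp.out.pos) _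
    filter_upwards [Metric.ball_mem_nhds z hpos] with y hy
    have hyz := (appr_eq_iff_norm_sub_le y z n).2 (dist_eq_norm y z ▸ (Metric.mem_ball.1 hy).le)
    change ((y.appr n : ℕ) : ZMod (p ^ n)) = ((z.appr n : ℕ) : ZMod (p ^ n))
    rw [hyz]
  have hf : Continuous f := (continuous_of_discreteTopology (f := ψ)).comp hcont
  refine ⟨(⟨f, hf⟩ : Multiplicative ℤ_[p] →ₜ* Circle), fun h => ?_⟩
  have h' : ψ (PadicInt.toZModPow n x) = ψ (PadicInt.toZModPow n y) := Circle.coe_injective h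
  exact hn (ZMod.injective_toCircle h')

variable [MeasurableSpace ℤ_[p]] [BorelSpace ℤ_[p]]

lemma measurableSet_digits_eq (d : ℕ) (l : Fin (d + 1) → Fin p) :
    MeasurableSet {x : ℤ_[p] | ∀ j : Fin (d + 1), digit x j = l j} := by
  have := (isLocallyConstant_digits (p := p) d).isOpen_fiber l
  convert this.measurableSet using 1
  ext x
  simp [digits, funext_iff]

/-- Integration of a function of the first `d + 1` digits that vanishes at `0`. -/
lemma integrable_comp_digits {d : ℕ} {g : (Fin (d + 1) → Fin p) → ℂ} (hg : g (digits d 0) = 0)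
    {μ : Measure ℤ_[p]} (hμ : ∀ l, l ≠ digits d 0 →
      μ {x | ∀ j : Fin (d + 1), digit x j = l j} ≠ ∞) :
    Integrable (fun x => g (digits d x)) μ ∧
      ∫ x, g (digits d x) ∂μ = ∑ l, μ.real {x | ∀ j : Fin (d + 1), digit x j = l j} • g l := by
  classical
  have heq : (fun x : ℤ_[p] => g (digits d x)) = fun x =>
      ∑ l, Set.indicator {x | ∀ j : Fin (d + 1), digit x j = l j} (fun _ => g l) x := by
    funext x
    rw [Finset.sum_eq_single (digits d x)]
    · rw [Set.indicator_of_mem]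
      exact fun j => rfl
    · intro l _ hl
      exact Set.indicator_of_notMem (fun h => hl (funext fun j => (h j).symm)) _
    · simp
  have hint : ∀ l, Integrable
      (Set.indicator {x : ℤ_[p] | ∀ j : Fin (d + 1), digit x j = l j} (fun _ => g l)) μ := by
    intro l
    -- The cylinder of `0` may have infinite measure, but its coefficient vanishes.
    by_cases hl : l = digits d 0
    · rw [hl, hg]
      simp
    · exact (integrable_indicator_iff (measurableSet_digits_eq d l)).2
        (integrableOn_const (hμ l hl))
  rw [heq]
  refine ⟨integrable_finsetSum _ fun l _ => hint l, ?_⟩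
  rw [integral_finsetSum _ fun l _ => hint l]
  exact Finset.sum_congr rfl fun l _ => integral_indicator_const _ (measurableSet_digits_eq d l)

end Digits

/-! ### The limit theorem -/

section Limit

/-- Infinitesimality of an array can be read off the digits. -/
lemma isInfinitesimal_of_tendsto_digits {p : ℕ} [Fact p.Prime] [MeasurableSpace ℤ_[p]]
    {Ω : ℕ → Type*} [∀ n, MeasurableSpace (Ω n)] {P : ∀ n, Measure (Ω n)} {K : ℕ → ℕ}
    {X : ∀ n, Fin (K n) → Ω n → ℤ_[p]}
    (hmax : ∀ d : ℕ,
      Tendsto (fun n => ⨆ k : Fin (K n), P n {ω | ∃ j ≤ d, (digit (X n k ω) j : ℕ) ≠ 0})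
        atTop (𝓝 0)) : IsInfinitesimal P X := by
  intro U hU _
  obtain ⟨d, hd⟩ := exists_digits_eq_subset hU
  refine tendsto_of_tendsto_of_tendsto_of_le_of_le tendsto_const_nhds (hmax d)
    (fun _ => zero_le) fun n => iSup_mono fun k => measure_mono fun ω hω => ?_
  rw [Set.mem_ofPred_eq, exists_digit_ne_zero_iff]
  exact fun h => hω (hd _ h)

variable {p : ℕ} [hp : Fact p.Prime] [MeasurableSpace ℤ_[p]] [BorelSpace ℤ_[p]]

/-- Probability measures on `ℤ_p` are determined by their Fourier transforms. -/
lemma probabilityMeasure_ext_of_integral_charVal {μ ν : ProbabilityMeasure ℤ_[p]}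
    (h : ∀ χ : Dual ℤ_[p],
      ∫ x, charVal χ x ∂(μ : Measure ℤ_[p]) = ∫ x, charVal χ x ∂(ν : Measure ℤ_[p])) : μ = ν :=
  Subtype.ext <| show (μ : Measure ℤ_[p]) = ν from
    measure_ext_of_integral_charVal (fun _ _ hxy => exists_charVal_ne hxy) h

/-- **Continuity theorem** on `ℤ_p`: pointwise convergence of the Fourier transforms of probability
measures implies weak convergence, and the limit function is a Fourier transform. -/
theorem exists_tendsto_of_tendsto_integral_charVal {μ : ℕ → ProbabilityMeasure ℤ_[p]}
    {φ : Dual ℤ_[p] → ℂ}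
    (h : ∀ χ : Dual ℤ_[p], Tendsto (fun n => ∫ x, charVal χ x ∂(μ n : Measure ℤ_[p])) atTop
      (𝓝 (φ χ))) :
    ∃ π : ProbabilityMeasure ℤ_[p], (∀ χ, ∫ x, charVal χ x ∂(π : Measure ℤ_[p]) = φ χ) ∧
      Tendsto μ atTop (𝓝 π) := by
  -- Every cluster point has transform `φ`, so there is at most one; compactness of the space of
  -- probability measures supplies one and turns uniqueness into convergence.
  have hcl : ∀ π : ProbabilityMeasure ℤ_[p], MapClusterPt π atTop μ →
      ∀ χ, ∫ x, charVal χ x ∂(π : Measure ℤ_[p]) = φ χ := by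
    intro π hπ χ
    have hcont : Continuous
        fun ν : ProbabilityMeasure ℤ_[p] => ∫ x, charVal χ x ∂(ν : Measure ℤ_[p]) :=
      continuous_iff_continuousAt.2 fun ν =>
        (ProbabilityMeasure.tendsto_iff_forall_integral_rclike_tendsto ℂ).1 tendsto_id (charBCF χ)
    have h1 := hπ.continuousAt_comp hcont.continuousAt
    have h2 : ClusterPt _ (𝓝 (φ χ)) := ClusterPt.mono h1 (h χ)
    exact eq_of_nhds_neBot h2
  obtain ⟨π, hπ⟩ := exists_clusterPt_of_compactSpace (map μ atTop)
  refine ⟨π, hcl π hπ, tendsto_nhds_of_unique_mapClusterPt fun ν hν => ?_⟩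
  refine probabilityMeasure_ext_of_integral_charVal fun χ => ?_
  exact (hcl ν hν χ).trans (hcl π hπ χ).symm

/-- Such a cylinder is disjoint from the cylinder of `0`, which is an open neighbourhood of `0`. -/
lemma IsLevyMeasure.measure_digits_ne_top {η : Measure ℤ_[p]} (hη : IsLevyMeasure η) (d : ℕ)
    {l : Fin (d + 1) → Fin p} (hl : l ≠ digits d 0) :
    η {x | ∀ j : Fin (d + 1), digit x j = l j} ≠ ∞ := by
  have hopen := (isLocallyConstant_digits (p := p) d).isOpen_fiber (digits d 0)
  refine ne_top_of_le_ne_top (hη.finite_compl _ (hopen.mem_nhds rfl) hopen.measurableSet).ne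
    (measure_mono fun x hx hx0 => hl ?_)
  rw [← hx0]
  exact funext fun j => (hx j).symm

variable {Ω : ℕ → Type*} [∀ n, MeasurableSpace (Ω n)] {P : ∀ n, Measure (Ω n)}
  [∀ n, IsProbabilityMeasure (P n)] {K : ℕ → ℕ} {X : ∀ n, Fin (K n) → Ω n → ℤ_[p]}

/-- The Fourier transforms of the row sums converge. -/
theorem tendsto_integral_charVal_sum
    (hmeas : ∀ n k, Measurable (X n k)) (hindep : ∀ n, iIndepFun (X n) (P n))
    {η : Measure ℤ_[p]} (hη : IsLevyMeasure η)
    (hmax : ∀ d : ℕ,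
      Tendsto (fun n => ⨆ k : Fin (K n), P n {ω | ∃ j ≤ d, (digit (X n k ω) j : ℕ) ≠ 0})
        atTop (𝓝 0))
    (hsum : ∀ (d : ℕ) (l : Fin (d + 1) → Fin p), (∃ j, (l j : ℕ) ≠ 0) →
      Tendsto (fun n => ∑ k : Fin (K n), P n {ω | ∀ j : Fin (d + 1), digit (X n k ω) j = l j})
        atTop (𝓝 (η {x | ∀ j : Fin (d + 1), digit x j = l j})))
    (χ : Dual ℤ_[p]) :
    Integrable (fun x => charVal χ x - 1) η ∧
    Tendsto (fun n => ∫ ω, charVal χ (∑ k, X n k ω) ∂(P n)) atTop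
      (𝓝 (Complex.exp (∫ x, (charVal χ x - 1) ∂η))) := by
  classical
  obtain ⟨d, g', hg', hg'1⟩ := exists_charVal_eq_comp_digits χ
  set g : (Fin (d + 1) → Fin p) → ℂ := fun l => g' l - 1 with hgdef
  have hg0 : g (digits d 0) = 0 := by
    rw [hgdef]
    simp only
    rw [← hg', charVal_zero, sub_self]
  have hgle : ∀ l, ‖g l‖ ≤ 2 := fun l =>
    (norm_sub_le _ _).trans (by rw [norm_one]; linarith [hg'1 l])
  have hχ : ∀ x, charVal χ x - 1 = g (digits d x) := fun x => by rw [hg' x]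
  obtain ⟨hint, hval⟩ := integrable_comp_digits hg0 (μ := η)
    fun l hl => hη.measure_digits_ne_top d hl
  simp_rw [hχ]
  refine ⟨hint, ?_⟩
  rw [hval]
  set a : ∀ n, Fin (K n) → (Fin (d + 1) → Fin p) → ℝ :=
    fun n k l => (P n).real {ω | ∀ j : Fin (d + 1), digit (X n k ω) j = l j} with ha
  have hatend : ∀ l, l ≠ digits d 0 → Tendsto (fun n => ∑ k, a n k l) atTop
      (𝓝 (η.real {x | ∀ j : Fin (d + 1), digit x j = l j})) := by
    intro l hl
    have h1 := (ENNReal.tendsto_toReal (hη.measure_digits_ne_top d hl)).comp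
      (hsum d l ((ne_digits_zero_iff d l).1 hl))
    refine h1.congr fun n => ?_
    exact ENNReal.toReal_sum fun k _ => measure_ne_top _ _
  set ε : ℕ → ℝ :=
    fun n => (⨆ k : Fin (K n), P n {ω | ∃ j ≤ d, (digit (X n k ω) j : ℕ) ≠ 0}).toReal with hεdef
  have hsup : ∀ n, (⨆ k : Fin (K n), P n {ω | ∃ j ≤ d, (digit (X n k ω) j : ℕ) ≠ 0}) ≠ ∞ :=
    fun n => ne_top_of_le_ne_top ENNReal.one_ne_top (iSup_le fun k => prob_le_one)
  have hεtend : Tendsto ε atTop (𝓝 0) := by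
    exact (ENNReal.tendsto_toReal ENNReal.zero_ne_top).comp (hmax d)
  have haε : ∀ n k l, l ≠ digits d 0 → a n k l ≤ ε n := by
    intro n k l hl
    refine ENNReal.toReal_mono (hsup n) (le_trans (measure_mono fun ω hω => ?_)
      (le_iSup (fun k => P n {ω | ∃ j ≤ d, (digit (X n k ω) j : ℕ) ≠ 0}) k))
    rw [Set.mem_ofPred_eq, exists_digit_ne_zero_iff]
    intro h
    exact hl (h ▸ funext fun j => (hω j).symm)
  have ha0 : ∀ n k l, 0 ≤ a n k l := fun n k l => measureReal_nonneg
  set z : ∀ n, Fin (K n) → ℂ := fun n k => ∑ l, a n k l • g l with hz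
  -- The cylinders partition the space, so `z n k` is the integral of `χ - 1` against the law of `X
  -- n k`.
  have hz1 : ∀ n k, 1 + z n k = ∫ ω, charVal χ (X n k ω) ∂(P n) := by
    intro n k
    have hprob : IsProbabilityMeasure ((P n).map (X n k)) :=
      Measure.isProbabilityMeasure_map (hmeas n k).aemeasurable
    obtain ⟨hi, hv⟩ := integrable_comp_digits hg0 (μ := (P n).map (X n k))
      fun l _ => measure_ne_top _ _
    have hzz : z n k = ∫ x, g (digits d x) ∂((P n).map (X n k)) := by
      rw [hv, hz]
      refine Finset.sum_congr rfl fun l _ => ?_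
      rw [map_measureReal_apply (hmeas n k) (measurableSet_digits_eq d l)]
      rfl
    rw [hzz, ← integral_map (hmeas n k).aemeasurable
      (continuous_charVal χ).aestronglyMeasurable]
    have : ∀ x, charVal χ x = 1 + g (digits d x) := fun x => by rw [← hχ]; ring
    simp_rw [this]
    rw [integral_add (integrable_const _) hi]
    simp
  have hzle : ∀ n k, ‖z n k‖ ≤ ∑ l ∈ Finset.univ.erase (digits d 0), 2 * a n k l := by
    intro n k
    rw [hz]
    simp only
    -- The cylinder of `0` must go before taking norms: its probability is not small.
    rw [← Finset.sum_erase Finset.univ (a := digits d 0) (by rw [hg0, smul_zero])]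
    refine norm_sum_le_of_le _ fun l _ => ?_
    rw [norm_smul, Real.norm_of_nonneg (ha0 n k l), mul_comm]
    exact mul_le_mul_of_nonneg_right (hgle l) (ha0 n k l)
  have hprod : ∀ n, ∫ ω, charVal χ (∑ k, X n k ω) ∂(P n) = ∏ k, (1 + z n k) := by
    intro n
    simp_rw [charVal_sum, hz1]
    exact (hindep n).integral_fun_prod_comp (fun k => (hmeas n k).aemeasurable)
      fun k => (continuous_charVal χ).aestronglyMeasurable
  simp_rw [hprod]
  set N : ℝ := ((Finset.univ.erase (digits (p := p) d 0)).card : ℝ)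
  have hbound : Tendsto (fun n => ∑ k, ∑ l ∈ Finset.univ.erase (digits d 0), 2 * a n k l) atTop
      (𝓝 (∑ l ∈ Finset.univ.erase (digits d 0),
        2 * η.real {x | ∀ j : Fin (d + 1), digit x j = l j})) := by
    simp_rw [Finset.sum_comm (s := Finset.univ (α := Fin (K _))), ← Finset.mul_sum]
    refine Tendsto.const_mul _ (tendsto_finsetSum _ fun l hl => ?_)
    exact hatend l (Finset.ne_of_mem_erase hl)
  -- Each of the `N` remaining cylinders contributes at most `2 * ε n`, as `‖g l‖ ≤ 2`. `M` exceeds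
  -- the limit of the row bounds by `1`, so it dominates them eventually.
  refine tendsto_prod_one_add_exp (ε := fun n => N * (2 * ε n))
    (M := (∑ l ∈ Finset.univ.erase (digits d 0),
        2 * η.real {x | ∀ j : Fin (d + 1), digit x j = l j}) + 1) ?_ ?_ ?_ ?_ ?_ ?_
  · intro n k
    rw [hz1]
    refine (norm_integral_le_of_norm_le_const (C := 1)
      (ae_of_all _ fun ω => (norm_charVal χ _).le)).trans ?_
    simp
  · intro n k
    refine (hzle n k).trans ?_
    rw [← nsmul_eq_mul]
    refine Finset.sum_le_card_nsmul _ _ _ fun l hl => ?_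
    linarith [haε n k l (Finset.ne_of_mem_erase hl)]
  · simpa using (hεtend.const_mul 2).const_mul N
  · exact fun n => mul_nonneg (Nat.cast_nonneg _) (mul_nonneg zero_le_two ENNReal.toReal_nonneg)
  · filter_upwards [hbound.eventually_le_const (lt_add_one _)] with n hn
    exact (Finset.sum_le_sum fun k _ => hzle n k).trans hn
  · have : ∀ n, ∑ k, z n k = ∑ l, (∑ k, a n k l) • g l := by
      intro n
      rw [hz, Finset.sum_comm]
      simp_rw [Finset.sum_smul]
    simp_rw [this]
    refine tendsto_finsetSum _ fun l _ => ?_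
    -- No convergence is known for the cylinder of `0`; its term is identically zero.
    by_cases hl : l = digits d 0
    · rw [hl, hg0]
      simp
    · exact (hatend l hl).smul_const _

end Limit

end PoissonLimit

open PoissonLimit in
theorem mainTheorem9 (p : ℕ) [Fact p.Prime] [MeasurableSpace ℤ_[p]] [BorelSpace ℤ_[p]]
    (Ω : ℕ → Type*) [∀ n, MeasurableSpace (Ω n)] (P : ∀ n, Measure (Ω n))
    [∀ n, IsProbabilityMeasure (P n)]
    (K : ℕ → ℕ) (X : ∀ n, Fin (K n) → Ω n → ℤ_[p])
    (hmeas : ∀ n k, Measurable (X n k))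
    (hindep : ∀ n, iIndepFun (X n) (P n))
    (η : Measure ℤ_[p]) (hη : IsLevyMeasure η)
    (hmax : ∀ d : ℕ,
      Tendsto (fun n => ⨆ k : Fin (K n), P n {ω | ∃ j ≤ d, (digit (X n k ω) j : ℕ) ≠ 0})
        atTop (𝓝 0))
    (hsum : ∀ (d : ℕ) (l : Fin (d + 1) → Fin p), (∃ j, (l j : ℕ) ≠ 0) →
      Tendsto (fun n => ∑ k : Fin (K n), P n {ω | ∀ j : Fin (d + 1), digit (X n k ω) j = l j})
        atTop (𝓝 (η {x | ∀ j : Fin (d + 1), digit x j = l j}))) :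
    IsInfinitesimal P X ∧
    ∃ π : ProbabilityMeasure ℤ_[p],
      IsGeneralizedPoisson η (zeroLocalInnerProduct p) π ∧
      (∀ ν : ProbabilityMeasure ℤ_[p],
        IsGeneralizedPoisson η (zeroLocalInnerProduct p) ν → ν = π) ∧
      TendstoInDistribution (fun n ω => ∑ k : Fin (K n), X n k ω) atTop id P
        (π : Measure ℤ_[p]) := by
  refine ⟨isInfinitesimal_of_tendsto_digits hmax, ?_⟩
  have hSmeas : ∀ n, Measurable fun ω => ∑ k, X n k ω := fun n =>
    Finset.measurable_sum _ fun k _ => hmeas n k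
  have key := tendsto_integral_charVal_sum hmeas hindep hη hmax hsum
  obtain ⟨π, hπ, hlim⟩ := exists_tendsto_of_tendsto_integral_charVal
    (μ := fun n => ⟨(P n).map fun ω => ∑ k, X n k ω,
      Measure.isProbabilityMeasure_map (hSmeas n).aemeasurable⟩)
    (φ := fun χ => Complex.exp (∫ x, (charVal χ x - 1) ∂η)) fun χ => by
      refine (key χ).2.congr fun n => ?_
      exact (integral_map (hSmeas n).aemeasurable
        (continuous_charVal χ).aestronglyMeasurable).symm
  have hg : ∀ (χ : Dual ℤ_[p]) (x : ℤ_[p]),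
      charVal χ x - 1 - Complex.I * ((zeroLocalInnerProduct p).toFun x χ : ℂ)
        = charVal χ x - 1 := by
    intro χ x
    simp [zeroLocalInnerProduct]
  refine ⟨π, fun χ => ?_, fun ν hν => ?_, ⟨fun n => (hSmeas n).aemeasurable, aemeasurable_id, ?_⟩⟩
  · simp_rw [hg]
    exact ⟨(key χ).1, hπ χ⟩
  · refine probabilityMeasure_ext_of_integral_charVal fun χ => ?_
    have h := (hν χ).2
    simp_rw [hg] at h
    exact h.trans (hπ χ).symm
  · convert hlim using 2
    exact congrArg 𝓝 (Subtype.ext Measure.map_id)
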